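/- An integer program (IP) with $m$ constraints and $n$ variables, $\max\{c^Tx : Ax\le b,\ x\ge 0,\ x\in\mathbb Z^n\}$ with $A\in\mathbb Z^{m\times n}$, $b\in\mathbb Z^m$, $c\in\mathbb R^n$, is written $(c,A,b)$; put $\|A\|_{1,1}=\sum_{i,j}|A_{ij}|$ and $\|b\|_1=\sum_i|b_i|$. Applying the Chvátal–Gomory (CG) cut defined by $u\in[0,1]^m$ to $(c,A,b)$ means appending to it the constraint $\lfloor u^TA\rfloor x\le\lfloor u^Tb\rfloor$. Let $m,n,W\ge 1$. For $u_1\in[0,1]^m,\ u_2\in[0,1]^{m+1},\ \dots,\ u_W\in[0,1]^{m+W-1}$, let $f_{u_1,\dots,u_W}(c,A,b)$ be the number of nodes of the search tree that branch-and-cut builds when, at the root, it applies the CG cut defined by $u_1$, then the CG cut defined by $u_2$ to the new IP (with $m+1$ constraints), and so on up to $u_W$. Apart from these cuts, all aspects of branch-and-cut are fixed: the choice among optimal LP solutions, the node selection policy, the variable selection policy, and a cap $\kappa$ on the tree size. A node is fathomed if its LP relaxation has no optimal solution, or has an integral solution, or has an optimal value no better than the best integral solution found so far; otherwise one branches on a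 variable $x[i]$ with fractional value $v$ in the LP solution, creating two children with the additional constraint $x[i]\le\lfloor v\rfloor$, respectively $x[i]\ge\lceil v\rceil$. For $\alpha,\beta\ge 0$ let $\mathcal F_{\alpha,\beta}$ be the set of all functions $f_{u_1,\dots,u_W}$ with $u_w\in[0,1]^{m+w-1}$ for $w=1,\dots,W$, on the domain of IPs $(c,A,b)$ with $m$ constraints and $n$ variables such that $\|A\|_{1,1}\le\alpha$ and $\|b\|_1\le\beta$. The pseudo-dimension $\operatorname{Pdim}(\mathcal F)$ of a class $\mathcal F\subseteq\mathbb R^{\mathcal Y}$ is the largest $N$ for which there are $y_1,\dots,y_N\in\mathcal Y$ and $r_1,\dots,r_N\in\mathbb R$ such that for every $\sigma\in\{0,1\}^N$ some $f\in\mathcal F$ satisfies, for all $i$, $f(y_i)\ge r_i$ if and only if $\sigma_i=1$. Theorem. $\operatorname{Pdim}(\mathcal F_{\alpha,\beta})=O\big(mW^2\log(mW(\alpha+\beta+n))\big)$; that is, there is an absolute constant $C>0$ such that, for all $m,n,W\ge1$, all $\alpha,\beta\ge0$, every cap $\kappa$ and all fixed rules of branch-and-cut, $\operatorname{Pdim}(\mathcal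 F_{\alpha,\beta})$ is finite and at most $C\,mW^2\log(mW(\alpha+\beta+n))$. -/

import Mathlib

/-- An integer program `max {cᵀx : A x ≤ b, x ≥ 0, x ∈ ℤⁿ}` in canonical form, with `m` constraints
and `n` variables, integral `A`, `b` and real `c`. -/
structure IntProg (m n : ℕ) where
  /-- the objective -/
  c : Fin n → ℝ
  /-- the constraint matrix -/
  A : Matrix (Fin m) (Fin n) ℤ
  /-- the constraint vector -/
  b : Fin m → ℤ

namespace IntProg

variable {m n : ℕ}

/-- The entrywise norm `‖A‖₁,₁ = ∑ |A i j|`. -/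
def normA (P : IntProg m n) : ℝ := ∑ i, ∑ j, |(P.A i j : ℝ)|

/-- The norm `‖b‖₁ = ∑ |b i|`. -/
def normb (P : IntProg m n) : ℝ := ∑ i, |(P.b i : ℝ)|

/-- The integer program obtained by appending, as its last constraint, the Chvátal-Gomory cut
`⌊uᵀA⌋ x ≤ ⌊uᵀb⌋` defined by `u`. -/
noncomputable def addCG (P : IntProg m n) (u : Fin m → ℝ) : IntProg (m + 1) n where
  c := P.c
  A := Fin.snoc (α := fun _ => Fin n → ℤ) P.A (fun j => ⌊∑ i, u i * (P.A i j : ℝ)⌋)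
  b := Fin.snoc (α := fun _ => ℤ) P.b ⌊∑ i, u i * (P.b i : ℝ)⌋

/-- The integer program after `W` sequential Chvátal-Gomory cuts. The cut with (zero-based) index
`w` has `m + w` parameters and is taken with respect to the program that already contains the
previous `w` cuts. -/
noncomputable def addCGs (P : IntProg m n) :
    (W : ℕ) → ((w : Fin W) → Fin (m + w) → ℝ) → IntProg (m + W) n
  | 0, _ => P
  | W + 1, u => (addCGs P W fun w => u w.castSucc).addCG (u (Fin.last W))

/-- The objective value of `x`. -/
def obj (P : IntProg m n) (x : Fin n → ℝ) : ℝ := ∑ j, P.c j * x j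

end IntProg

/-- A branching constraint: `x j ≤ k` or `x j ≥ k`. -/
inductive BranchCon (n : ℕ)
  | le (j : Fin n) (k : ℤ)
  | ge (j : Fin n) (k : ℤ)
  deriving DecidableEq

/-- `x` satisfies the branching constraint. -/
def BranchCon.Holds {n : ℕ} : BranchCon n → (Fin n → ℝ) → Prop
  | .le j k, x => x j ≤ k
  | .ge j k, x => (k : ℝ) ≤ x j

/-- A node of the search tree, identified with the list of the branching constraints on the path
from the root to it. The root is `[]`; the children of `ν` have the form `h :: ν`. -/
abbrev BBNode (n : ℕ) := List (BranchCon n)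

/-- The feasible region of the LP relaxation at the node `ν`. -/
def lpRegion {m n : ℕ} (P : IntProg m n) (ν : BBNode n) : Set (Fin n → ℝ) :=
  {x | (∀ i, ∑ j, (P.A i j : ℝ) * x j ≤ (P.b i : ℝ)) ∧ (∀ j, 0 ≤ x j) ∧ ∀ h ∈ ν, h.Holds x}

/-- `x` is an optimal solution of the LP relaxation at the node `ν`. -/
def IsLPOptimal {m n : ℕ} (P : IntProg m n) (ν : BBNode n) (x : Fin n → ℝ) : Prop :=
  x ∈ lpRegion P ν ∧ ∀ y ∈ lpRegion P ν, P.obj y ≤ P.obj x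

/-- `x` has integral coordinates. -/
def IsIntegralVec {n : ℕ} (x : Fin n → ℝ) : Prop := ∀ j, ∃ k : ℤ, x j = k

/-- A snapshot of branch-and-cut: all nodes of the tree built so far, the leaves that still have to
be explored, and the best integral solution found so far. -/
structure BBState (n : ℕ) where
  /-- all nodes of the tree built so far -/
  tree : List (BBNode n)
  /-- the leaves that have not been explored yet -/
  frontier : List (BBNode n)
  /-- the incumbent -/
  incumbent : Option (Fin n → ℝ)

/-- The aspects of branch-and-cut that stay fixed when the cuts at the root vary: how LP relaxations
are solved (that is, how ties between optimal solutions are broken), the node selection policy and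
the variable selection policy. The policies may look at the program and at the whole search. -/
structure BBRules (m n : ℕ) where
  /-- the LP solver -/
  lpSol : IntProg m n → BBNode n → (Fin n → ℝ)
  /-- it returns an optimal solution whenever there is one -/
  lpSol_optimal : ∀ P ν, (∃ x, IsLPOptimal P ν x) → IsLPOptimal P ν (lpSol P ν)
  /-- the node selection policy -/
  nodeSel : IntProg m n → BBState n → BBNode n
  /-- it selects an unexplored leaf -/
  nodeSel_mem : ∀ P S, S.frontier ≠ [] → nodeSel P S ∈ S.frontier
  /-- the variable selection policy, at a given node -/
  varSel : IntProg m n → BBState n → BBNode n → Fin n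
  /-- it selects a variable with a fractional value in the LP solution -/
  varSel_frac : ∀ P S ν, ¬ IsIntegralVec (lpSol P ν) →
    ¬ ∃ k : ℤ, lpSol P ν (varSel P S ν) = k

namespace BBRules

variable {m n : ℕ}

open Classical in
/-- One round of branch-and-cut with tree-size cap `κ` on the program `P`. The search is over once
no unexplored leaf is left; it is terminated when branching would give a tree with more than `κ`
nodes. (In both cases the state no longer changes.) A node whose LP relaxation has no optimal
solution, because it is infeasible or unbounded, is not branched on. -/
noncomputable def step (R : BBRules m n) (κ : ℕ) (P : IntProg m n) (S : BBState n) : BBState n :=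
  if S.frontier = [] then S
  else
    let ν := R.nodeSel P S
    let x := R.lpSol P ν
    let rest := S.frontier.erase ν
    if ¬ ∃ y, IsLPOptimal P ν y then
      { S with frontier := rest }
    else if ∃ z ∈ S.incumbent, P.obj x ≤ P.obj z then
      { S with frontier := rest }
    else if IsIntegralVec x then
      { S with frontier := rest, incumbent := some x }
    else if S.tree.length + 2 ≤ κ then
      let j := R.varSel P S ν
      let left : BBNode n := .le j ⌊x j⌋ :: ν
      let right : BBNode n := .ge j ⌈x j⌉ :: ν
      { S with tree := left :: right :: S.tree, frontier := left :: right :: rest }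
    else S

/-- The initial state: the tree consists of the unexplored root. -/
def init (n : ℕ) : BBState n := ⟨[[]], [[]], none⟩

/-- The number of nodes of the tree that branch-and-cut builds on `P` with tree-size cap `κ`. Every
round that changes the state explores a new node, so after `κ` rounds the search has stopped. -/
noncomputable def treeSize (R : BBRules m n) (κ : ℕ) (P : IntProg m n) : ℕ :=
  ((R.step κ P)^[κ] (init n)).tree.length

end BBRules

/-- The integer programs with `‖A‖₁,₁ ≤ α` and `‖b‖₁ ≤ β`. -/
abbrev BoundedIP (m n : ℕ) (α β : ℝ) := {P : IntProg m n // P.normA ≤ α ∧ P.normb ≤ β}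

/-- The class of all functions `f_{u₁,…,u_W}`, `u_w ∈ [0,1]^{m+w-1}`, on the integer programs with
`‖A‖₁,₁ ≤ α` and `‖b‖₁ ≤ β`, where `f_{u₁,…,u_W}` is the size of the tree that branch-and-cut builds
after the corresponding `W` sequential Chvátal-Gomory cuts have been applied at the root. -/
def treeSizeClass {m n W : ℕ} (R : BBRules (m + W) n) (κ : ℕ) (α β : ℝ) :
    Set (BoundedIP m n α β → ℝ) :=
  {f | ∃ u : (w : Fin W) → Fin (m + w) → ℝ, (∀ w i, u w i ∈ Set.Icc (0 : ℝ) 1) ∧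
    f = fun P => (R.treeSize κ (P.1.addCGs W u) : ℝ)}

/-- There are `N` inputs and `N` thresholds for which `F` realizes all `2 ^ N` patterns. -/
def PseudoShatters {Y : Type*} (F : Set (Y → ℝ)) (N : ℕ) : Prop :=
  ∃ (y : Fin N → Y) (r : Fin N → ℝ), ∀ σ : Fin N → Bool, ∃ f ∈ F, ∀ i, r i ≤ f (y i) ↔ σ i = true

/-- The pseudo-dimension: the largest `N` with `PseudoShatters F N`, or `⊤` if there is none. -/
noncomputable def pseudoDim {Y : Type*} (F : Set (Y → ℝ)) : ℕ∞ :=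
  ⨆ (N : ℕ) (_ : PseudoShatters F N), (N : ℕ∞)

/-! The tree size depends on the cut parameters only through the program left after the cuts,
whatever the rules of branch-and-cut. Placing the columns of `A` and `b` of `N` shattered programs
side by side gives one integer matrix, rounded with common weights, and the `2 ^ N` patterns need `2
^ N` distinct final matrices. It therefore suffices to count these matrices, one appended row at a
time.

Given the previous rows, the next one consists of floors of linear forms in `m + w` weights. The
appended rows can have entries exponential in `w`, so counting all integer thresholds of these forms
is too expensive. Instead, `sum_mul_addFloorRow` rewrites a combination involving an appended row as
a combination of the earlier rows, up to an error in which only a fractional part multiplies the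
last weight. Unwinding this down to the original rows, `exists_grid` splits the cube into
polynomially many classes per coordinate on which every form varies by at most 1. On one class each
floor has three candidates, and Sauer–Shelah bounds the joint patterns
(`exists_finset_floor_of_close`). Over `W` rows the exponent is `(m + W) * W ≤ 2 * m * W ^ 2`;
solving the resulting inequality for `N` gives the bound. -/

/-! ### Sequential rounding of integer rows -/

/-- The rows `R` followed by the rounded-down combination of its rows with weights `u`. -/
noncomputable def addFloorRow {k : ℕ} {ι : Type*} (R : Fin k → ι → ℤ) (u : Fin k → ℝ) :
    Fin (k + 1) → ι → ℤ :=
  Fin.snoc (α := fun _ => ι → ℤ) R (fun c => ⌊∑ i, u i * (R i c : ℝ)⌋)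

/-- `W` sequential applications of `addFloorRow`. -/
noncomputable def addFloorRows {m : ℕ} {ι : Type*} (R : Fin m → ι → ℤ) :
    (W : ℕ) → ((w : Fin W) → Fin (m + w) → ℝ) → Fin (m + W) → ι → ℤ
  | 0, _ => R
  | W + 1, u => addFloorRow (addFloorRows R W fun w => u w.castSucc) (u (Fin.last W))

/-- Writing the floor as the sum minus its fractional part moves the weight of the new row onto the
old rows. The remaining error has a coefficient in `[0, 1)`, however large the new row is. -/
lemma sum_mul_addFloorRow {k : ℕ} {ι : Type*} (R : Fin k → ι → ℤ) (u : Fin k → ℝ)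
    (v : Fin (k + 1) → ℝ) (c : ι) :
    ∑ i, v i * (addFloorRow R u i c : ℝ) =
      ∑ i, (v i.castSucc + v (Fin.last k) * u i) * (R i c : ℝ) -
        v (Fin.last k) * Int.fract (∑ i, u i * (R i c : ℝ)) := by
  rw [Fin.sum_univ_castSucc]
  simp only [addFloorRow, Fin.snoc_castSucc, Fin.snoc_last, Int.fract]
  simp only [add_mul, Finset.sum_add_distrib, mul_assoc, ← Finset.mul_sum]
  ring

/-! ### Floor patterns via Sauer–Shelah -/

/-- Sets cut out by affine inequalities in `k` variables shatter at most `k + 1` of them. -/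
lemma vcDim_affine_le {k : ℕ} {E : Type*} [Fintype E] [DecidableEq E] (a : E → Fin k → ℝ)
    (z : E → ℝ) (𝒜 : Finset (Finset E))
    (h𝒜 : ∀ s ∈ 𝒜, ∃ v : Fin k → ℝ, ∀ e, e ∈ s ↔ z e ≤ ∑ i, v i * a e i) :
    𝒜.vcDim ≤ k + 1 := by
  refine Finset.sup_le fun T hT => ?_
  rw [Finset.mem_shatterer] at hT
  by_contra! hcard
  have hdep : ¬ LinearIndependent ℝ (fun e : T => ((a e, z e) : (Fin k → ℝ) × ℝ)) := by
    intro hli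
    have := hli.fintype_card_le_finrank
    simp at this
    omega
  rw [Fintype.not_linearIndependent_iff] at hdep
  obtain ⟨μ, hμ, e₀, he₀⟩ := hdep
  -- If `v` realizes the subset `{μ ≥ 0}`, then `∑ μ e * (v · a e - z e)` has no negative term, and
  -- a positive one wherever `μ e < 0`; but the relation makes it zero. Applying this to `-μ` as
  -- well forces `μ = 0`.
  have key : ∀ μ : T → ℝ, ∑ e, μ e • ((a e, z e) : (Fin k → ℝ) × ℝ) = 0 →
      ∀ e, 0 ≤ μ e := by
    intro μ hμ e
    by_contra! hneg
    classical
    obtain ⟨s, hs, hTs⟩ := hT (t := (Finset.univ.filter fun e : T => 0 ≤ μ e).map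
      (Function.Embedding.subtype _)) (by
        intro x hx
        simp only [Finset.mem_map] at hx
        obtain ⟨y, -, rfl⟩ := hx
        exact y.2)
    obtain ⟨v, hv⟩ := h𝒜 s hs
    have hmem : ∀ e : T, (z e ≤ ∑ i, v i * a e i) ↔ 0 ≤ μ e := by
      intro e
      rw [← hv]
      have := Finset.ext_iff.1 hTs (e : E)
      simpa using this
    have h1 : ∀ i, ∑ e, μ e * a e i = 0 := by
      intro i
      have := congrFun (congrArg Prod.fst hμ) i
      simpa [Prod.fst_sum] using this
    have h2 : ∑ e, μ e * z e = 0 := by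
      have := congrArg Prod.snd hμ
      simpa [Prod.snd_sum] using this
    have h3 : ∑ e : T, μ e * ((∑ i, v i * a e i) - z e) = 0 := by
      simp only [mul_sub, Finset.sum_sub_distrib, h2, sub_zero, Finset.mul_sum]
      rw [Finset.sum_comm]
      refine Finset.sum_eq_zero fun i _ => ?_
      calc ∑ e : T, μ e * (v i * a e i) = v i * ∑ e : T, μ e * a e i := by
            rw [Finset.mul_sum]; exact Finset.sum_congr rfl fun _ _ => by ring
        _ = 0 := by rw [h1, mul_zero]
    have h4 : 0 < ∑ e : T, μ e * ((∑ i, v i * a e i) - z e) := by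
      refine Finset.sum_pos' (fun e _ => ?_) ⟨e, Finset.mem_univ _, ?_⟩
      · rcases le_or_gt 0 (μ e) with h | h
        · exact mul_nonneg h (sub_nonneg.2 ((hmem e).2 h))
        · have := lt_of_not_ge (mt (hmem e).1 (not_le.2 h))
          exact (mul_pos_of_neg_of_neg h (sub_neg.2 this)).le
      · have := lt_of_not_ge (mt (hmem e).1 (not_le.2 hneg))
        exact mul_pos_of_neg_of_neg hneg (sub_neg.2 this)
    exact h4.ne' h3
  refine he₀ (le_antisymm ?_ (key μ hμ e₀))
  have := key (fun e => - μ e)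
    (by simp only [neg_smul, Finset.sum_neg_distrib, hμ, neg_zero]) e₀
  linarith

lemma sum_choose_le_pow (n d : ℕ) : ∑ i ∈ Finset.Iic d, n.choose i ≤ (n + 1) ^ d := by
  rw [add_pow, ← Nat.range_succ_eq_Iic]
  refine Finset.sum_le_sum fun i hi => ?_
  have hi' : i ≤ d := Nat.lt_succ_iff.1 (Finset.mem_range.1 hi)
  rw [one_pow, mul_one]
  exact (Nat.choose_le_pow n i).trans (Nat.le_mul_of_pos_right _ (Nat.choose_pos hi'))

/-- Linear forms each of which varies by at most `1` on `V` have few patterns of floors on `V`. -/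
lemma exists_finset_floor_of_close {k : ℕ} {ι : Type*} [Fintype ι] (R : Fin k → ι → ℤ)
    (V : Set (Fin k → ℝ))
    (hV : ∀ v ∈ V, ∀ v' ∈ V, ∀ c, |∑ i, v i * (R i c : ℝ) - ∑ i, v' i * (R i c : ℝ)| ≤ 1) :
    ∃ T : Finset (ι → ℤ), (∀ v ∈ V, (fun c => ⌊∑ i, v i * (R i c : ℝ)⌋) ∈ T) ∧
      T.card ≤ (2 * Fintype.card ι + 1) ^ (k + 1) := by
  classical
  rcases V.eq_empty_or_nonempty with rfl | ⟨v₀, hv₀⟩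
  · exact ⟨∅, by simp, by simp⟩
  set f : ι → ℤ := fun c => ⌊∑ i, v₀ i * (R i c : ℝ)⌋ with hf
  let a : ι ⊕ ι → Fin k → ℝ := fun e i => R i (Sum.elim id id e)
  -- On `V` the floor in column `c` is `f c - 1`, `f c` or `f c + 1`, so two thresholds per column
  -- determine it; `dec` reads it off.
  let z : ι ⊕ ι → ℝ := Sum.elim (fun c => (f c : ℝ)) (fun c => (f c : ℝ) + 1)
  let pos : (Fin k → ℝ) → Finset (ι ⊕ ι) := fun v =>
    Finset.univ.filter fun e => z e ≤ ∑ i, v i * a e i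
  let 𝒜 : Finset (Finset (ι ⊕ ι)) := Finset.univ.filter fun s => ∃ v, s = pos v
  let dec : Finset (ι ⊕ ι) → ι → ℤ := fun s c =>
    f c - 1 + (if Sum.inl c ∈ s then 1 else 0) + (if Sum.inr c ∈ s then 1 else 0)
  refine ⟨𝒜.image dec, fun v hv => ?_, ?_⟩
  · refine Finset.mem_image.2 ⟨pos v, by simp [𝒜], ?_⟩
    funext c
    have hc := abs_le.1 (hV v hv v₀ hv₀ c)
    have h1 := Int.floor_le (∑ i, v₀ i * (R i c : ℝ))
    have h2 := Int.lt_floor_add_one (∑ i, v₀ i * (R i c : ℝ))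
    change (f c : ℝ) ≤ _ at h1
    change _ < (f c : ℝ) + 1 at h2
    symm
    have hl : Sum.inl c ∈ pos v ↔ (f c : ℝ) ≤ ∑ i, v i * (R i c : ℝ) := by simp [pos, z, a]
    have hr : Sum.inr c ∈ pos v ↔ (f c : ℝ) + 1 ≤ ∑ i, v i * (R i c : ℝ) := by simp [pos, z, a]
    simp only [dec, hl, hr]
    rw [Int.floor_eq_iff]
    split_ifs <;> push_cast <;> constructor <;> linarith
  · calc (𝒜.image dec).card ≤ 𝒜.card := Finset.card_image_le
      _ ≤ 𝒜.shatterer.card := 𝒜.card_le_card_shatterer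
      _ ≤ ∑ i ∈ Finset.Iic 𝒜.vcDim, (Fintype.card (ι ⊕ ι)).choose i :=
        Finset.card_shatterer_le_sum_vcDim
      _ ≤ (Fintype.card (ι ⊕ ι) + 1) ^ 𝒜.vcDim := sum_choose_le_pow _ _
      _ ≤ (Fintype.card (ι ⊕ ι) + 1) ^ (k + 1) := by
        refine Nat.pow_le_pow_right (Nat.succ_pos _) (vcDim_affine_le a z 𝒜 fun s hs => ?_)
        obtain ⟨v, rfl⟩ := (Finset.mem_filter.1 hs).2
        exact ⟨v, fun e => by simp [pos]⟩
      _ = (2 * Fintype.card ι + 1) ^ (k + 1) := by rw [Fintype.card_sum, two_mul]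

/-! ### Grid classes and the count of rounded matrices -/

/-- A box of side at most `(G + t) / G` is split into at most `H ^ (m + w)` classes on each of which
all combinations of the rows vary little. The point is that `H` does not grow with the size of the
appended rows, which may be exponential in `w`. -/
lemma exists_grid {m : ℕ} {ι : Type*} (R : Fin m → ι → ℤ) (B : ι → ℝ)
    (hB : ∀ c, ∑ i, |(R i c : ℝ)| ≤ B c) (G : ℕ) (hG : 0 < G) (H : ℕ) :
    ∀ (w : ℕ) (u : (w' : Fin w) → Fin (m + w') → ℝ), (∀ w' i, u w' i ∈ Set.Icc (0 : ℝ) 1) →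
    ∀ (t : ℕ), G + t + w < H → ∀ p : Fin (m + w) → ℝ,
    ∃ g : (Fin (m + w) → ℝ) → Fin (m + w) → ℕ,
      (∀ v, (∀ i, p i ≤ v i ∧ (v i - p i) * G ≤ G + t) → ∀ i, g v i < H) ∧
      ∀ v v', (∀ i, p i ≤ v i ∧ (v i - p i) * G ≤ G + t) →
        (∀ i, p i ≤ v' i ∧ (v' i - p i) * G ≤ G + t) → g v = g v' →
        ∀ c, |∑ i, v i * (addFloorRows R w u i c : ℝ) - ∑ i, v' i * (addFloorRows R w u i c : ℝ)|
          * G ≤ B c + w := by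
  have hG' : (0 : ℝ) < G := by exact_mod_cast hG
  have floor_lt : ∀ (x : ℝ) (t H : ℕ), x ≤ G + t → G + t < H → ⌊x⌋₊ < H := by
    intro x t H hx hH
    refine (Nat.floor_lt' (by omega)).2 ?_
    have : ((G + t : ℕ) : ℝ) < H := by exact_mod_cast hH
    push_cast at this
    linarith
  have floor_close : ∀ x y : ℝ, 0 ≤ x → 0 ≤ y → ⌊x⌋₊ = ⌊y⌋₊ → |x - y| ≤ 1 := by
    intro x y hx hy h
    have h1 := Nat.floor_le hx
    have h2 := Nat.lt_floor_add_one x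
    have h3 := Nat.floor_le hy
    have h4 := Nat.lt_floor_add_one y
    rw [h] at h1 h2
    rw [abs_le]; constructor <;> linarith
  have snoc_lt : ∀ (k : ℕ) (x : Fin k → ℕ) (b : ℕ), (∀ i, x i < H) → b < H →
      ∀ i, Fin.snoc (α := fun _ => ℕ) x b i < H := by
    intro k x b hx hb i
    refine Fin.lastCases ?_ (fun i => ?_) i
    · rwa [Fin.snoc_last]
    · rw [Fin.snoc_castSucc]; exact hx i
  have snoc_inj : ∀ (k : ℕ) (x x' : Fin k → ℕ) (b b' : ℕ),
      Fin.snoc (α := fun _ => ℕ) x b = Fin.snoc (α := fun _ => ℕ) x' b' → x = x' ∧ b = b' :=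
    fun k x x' b b' h => ⟨by
      funext i
      simpa using congrFun h i.castSucc, by simpa using congrFun h (Fin.last k)⟩
  intro w
  induction w with
  | zero =>
    intro u _ t hH p
    refine ⟨fun v i => ⌊(v i - p i) * G⌋₊, fun v hv i => floor_lt _ t H (hv i).2 (by omega), ?_⟩
    intro v v' hv hv' hg c
    have hd : ∀ i, |v i - v' i| * G ≤ 1 := by
      intro i
      have := floor_close _ _ (mul_nonneg (sub_nonneg.2 (hv i).1) hG'.le)
        (mul_nonneg (sub_nonneg.2 (hv' i).1) hG'.le) (congrFun hg i)
      rwa [← sub_mul, sub_sub_sub_cancel_right, abs_mul, abs_of_pos hG'] at this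
    simp only [addFloorRows, Nat.cast_zero, add_zero]
    refine le_trans ?_ (hB c)
    rw [← Finset.sum_sub_distrib]
    calc |∑ i, (v i * (R i c : ℝ) - v' i * (R i c : ℝ))| * G
        ≤ (∑ i, |v i * (R i c : ℝ) - v' i * (R i c : ℝ)|) * G := by
          gcongr; exact Finset.abs_sum_le_sum_abs _ _
      _ = ∑ i, (|v i - v' i| * G) * |(R i c : ℝ)| := by
          rw [Finset.sum_mul]
          refine Finset.sum_congr rfl fun i _ => ?_
          rw [← sub_mul, abs_mul]; ring
      _ ≤ ∑ i, |(R i c : ℝ)| := Finset.sum_le_sum fun i _ => by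
          have := mul_le_mul_of_nonneg_right (hd i) (abs_nonneg (R i c : ℝ))
          linarith
  | succ w ih =>
    intro u hu t hH p
    set u' : (w' : Fin w) → Fin (m + w') → ℝ := fun w' => u w'.castSucc with hu'
    set ul : Fin (m + w) → ℝ := u (Fin.last w) with hul
    set L : Fin (m + w + 1) := Fin.last (m + w) with hL
    have hul01 : ∀ i, 0 ≤ ul i ∧ ul i ≤ 1 := fun i => hu (Fin.last w) i
    -- The last weight is gridded first. Its cell `a` fixes the corner of the box containing the
    -- transferred weights `lam`, so the inner grid depends on `a`. The variation of the last weight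
    -- within its cell lengthens that box by at most `1 / G`, whence `t + 1`.
    choose g hg1 hg2 using fun a : ℕ => ih u' (fun w' i => hu w'.castSucc i) (t + 1) (by omega)
      (fun i => p (Fin.castSucc i) + (p L + a / G) * ul i)
    let q : (Fin (m + w + 1) → ℝ) → ℕ := fun v => ⌊(v L - p L) * G⌋₊
    let lam : (Fin (m + w + 1) → ℝ) → Fin (m + w) → ℝ := fun v i =>
      v (Fin.castSucc i) + v L * ul i
    have hbox : ∀ v : Fin (m + w + 1) → ℝ, (∀ i, p i ≤ v i ∧ (v i - p i) * G ≤ G + t) →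
        ∀ i, p (Fin.castSucc i) + (p L + (q v : ℝ) / G) * ul i ≤ lam v i ∧
          (lam v i - (p (Fin.castSucc i) + (p L + (q v : ℝ) / G) * ul i)) * G
            ≤ G + (t + 1 : ℕ) := by
      intro v hv i
      have h0 : 0 ≤ (v L - p L) * G := mul_nonneg (sub_nonneg.2 (hv L).1) hG'.le
      have h1 : (q v : ℝ) ≤ (v L - p L) * G := Nat.floor_le h0
      have h2 : (v L - p L) * G < q v + 1 := Nat.lt_floor_add_one _
      obtain ⟨h3, h4⟩ := hv (Fin.castSucc i)
      obtain ⟨h5, h6⟩ := hul01 i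
      have e : (lam v i - (p (Fin.castSucc i) + (p L + (q v : ℝ) / G) * ul i)) * G =
          (v (Fin.castSucc i) - p (Fin.castSucc i)) * G + ((v L - p L) * G - q v) * ul i := by
        simp only [lam]; field_simp; ring
      have h7 : 0 ≤ ((v L - p L) * G - q v) * ul i := mul_nonneg (by linarith) h5
      have h8 : ((v L - p L) * G - q v) * ul i ≤ 1 := mul_le_one₀ (by linarith) h5 h6
      constructor
      · have h9 : 0 ≤ (lam v i - (p (Fin.castSucc i) + (p L + (q v : ℝ) / G) * ul i)) * G := by
          rw [e]; exact add_nonneg (mul_nonneg (sub_nonneg.2 h3) hG'.le) h7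
        exact sub_nonneg.1 (nonneg_of_mul_nonneg_left h9 hG')
      · rw [e]; push_cast; linarith
    refine ⟨fun v => Fin.snoc (α := fun _ => ℕ) (g (q v) (lam v)) (q v), ?_, ?_⟩
    · intro v hv
      exact snoc_lt _ _ _ (hg1 (q v) (lam v) (hbox v hv)) (floor_lt _ t H (hv L).2 (by omega))
    · intro v v' hv hv' hgg c
      obtain ⟨hgl, hq⟩ := snoc_inj _ _ _ _ _ hgg
      rw [← hq] at hgl
      have h1 := hg2 (q v) (lam v) (lam v') (hbox v hv) (hq ▸ hbox v' hv') hgl c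
      have h2 : |v L - v' L| * G ≤ 1 := by
        have := floor_close _ _ (mul_nonneg (sub_nonneg.2 (hv L).1) hG'.le)
          (mul_nonneg (sub_nonneg.2 (hv' L).1) hG'.le) hq
        rwa [← sub_mul, sub_sub_sub_cancel_right, abs_mul, abs_of_pos hG'] at this
      have e : ∀ v : Fin (m + w + 1) → ℝ,
          ∑ i, v i * (addFloorRows R (w + 1) u i c : ℝ) =
          ∑ i, lam v i * (addFloorRows R w u' i c : ℝ) -
            v L * Int.fract (∑ i, ul i * (addFloorRows R w u' i c : ℝ)) :=
        fun v => sum_mul_addFloorRow _ _ _ _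
      set s := Int.fract (∑ i, ul i * (addFloorRows R w u' i c : ℝ)) with hs
      have hs0 : 0 ≤ s := Int.fract_nonneg _
      have hs1 : s ≤ 1 := (Int.fract_lt_one _).le
      have e1 : ∑ i, v i * (addFloorRows R (w + 1) u i c : ℝ) =
        ∑ i, lam v i * (addFloorRows R w u' i c : ℝ) - v L * s := e v
      have e2 : ∑ i, v' i * (addFloorRows R (w + 1) u i c : ℝ) =
        ∑ i, lam v' i * (addFloorRows R w u' i c : ℝ) - v' L * s := e v'
      rw [e1, e2]
      set X := ∑ i, lam v i * (addFloorRows R w u' i c : ℝ)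
      set Y := ∑ i, lam v' i * (addFloorRows R w u' i c : ℝ)
      have h3 : |X - v L * s - (Y - v' L * s)| ≤ |X - Y| + |v L - v' L| := by
        have : X - v L * s - (Y - v' L * s) = (X - Y) - (v L - v' L) * s := by ring
        rw [this]
        refine (abs_sub _ _).trans ?_
        rw [abs_mul, abs_of_nonneg hs0]
        have := mul_le_of_le_one_right (abs_nonneg (v L - v' L)) hs1
        linarith
      calc |X - v L * s - (Y - v' L * s)| * G ≤ (|X - Y| + |v L - v' L|) * G := by gcongr
        _ ≤ B c + (w + 1 : ℕ) := by push_cast; linarith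

/-- The number of possible next rows, given the previous ones. -/
lemma exists_finset_next_row {m : ℕ} {ι : Type*} [Fintype ι] (R : Fin m → ι → ℤ) (B : ι → ℝ)
    (hB : ∀ c, ∑ i, |(R i c : ℝ)| ≤ B c) (G w : ℕ) (hG : 0 < G) (hBG : ∀ c, B c + w ≤ G)
    (u : (w' : Fin w) → Fin (m + w') → ℝ) (hu : ∀ w' i, u w' i ∈ Set.Icc (0 : ℝ) 1) :
    ∃ T : Finset (ι → ℤ),
      (∀ v : Fin (m + w) → ℝ, (∀ i, v i ∈ Set.Icc (0 : ℝ) 1) →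
        (fun c => ⌊∑ i, v i * (addFloorRows R w u i c : ℝ)⌋) ∈ T) ∧
      T.card ≤ (G + w + 1) ^ (m + w) * (2 * Fintype.card ι + 1) ^ (m + w + 1) := by
  classical
  have hG' : (0 : ℝ) < G := by exact_mod_cast hG
  -- The unit cube is the box with corner `0` and slack `t = 0`; `G + w + 1` is the least admissible
  -- `H`.
  obtain ⟨g, hg1, hg2⟩ := exists_grid R B hB G hG (G + w + 1) w u hu 0 (by omega) 0
  have hbox : ∀ v : Fin (m + w) → ℝ, (∀ i, v i ∈ Set.Icc (0 : ℝ) 1) →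
      ∀ i, (0 : Fin (m + w) → ℝ) i ≤ v i ∧ (v i - (0 : Fin (m + w) → ℝ) i) * G ≤ G + (0 : ℕ) := by
    intro v hv i
    have h := mul_le_mul_of_nonneg_right (hv i).2 hG'.le
    simp only [Pi.zero_apply, sub_zero, Nat.cast_zero, add_zero]
    exact ⟨(hv i).1, by linarith⟩
  choose T hT1 hT2 using fun q : Fin (m + w) → ℕ =>
    exists_finset_floor_of_close (addFloorRows R w u)
      {v | (∀ i, v i ∈ Set.Icc (0 : ℝ) 1) ∧ g v = q} (by
        rintro v ⟨hv, rfl⟩ v' ⟨hv', hq⟩ c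
        have h1 := (hg2 v v' (hbox v hv) (hbox v' hv') hq.symm c).trans (hBG c)
        by_contra! h2
        have := mul_lt_mul_of_pos_right h2 hG'
        linarith)
  refine ⟨(Fintype.piFinset fun _ : Fin (m + w) => Finset.range (G + w + 1)).biUnion T, ?_, ?_⟩
  · intro v hv
    refine Finset.mem_biUnion.2 ⟨g v, ?_, hT1 (g v) v ⟨hv, rfl⟩⟩
    exact Fintype.mem_piFinset.2 fun i => Finset.mem_range.2 (hg1 v (hbox v hv) i)
  · refine (Finset.card_biUnion_le_card_mul _ _ _ fun q _ => hT2 q).trans ?_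
    rw [Fintype.card_piFinset]
    simp

/-- The number of matrices that `W` sequential roundings can produce. -/
lemma exists_finset_addFloorRows {m : ℕ} {ι : Type*} [Fintype ι] (R : Fin m → ι → ℤ) (B : ι → ℝ)
    (hB : ∀ c, ∑ i, |(R i c : ℝ)| ≤ B c) (G W : ℕ) (hG : 0 < G) (hBG : ∀ c, B c + W ≤ G) :
    ∀ w ≤ W, ∃ T : Finset (Fin (m + w) → ι → ℤ),
      (∀ u : (w' : Fin w) → Fin (m + w') → ℝ, (∀ w' i, u w' i ∈ Set.Icc (0 : ℝ) 1) →
        addFloorRows R w u ∈ T) ∧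
      T.card ≤ (((G + W + 1) * (2 * Fintype.card ι + 1)) ^ (m + W)) ^ w := by
  classical
  intro w
  induction w with
  | zero =>
    intro _
    exact ⟨{R}, fun u _ => by simp [addFloorRows], by simp⟩
  | succ w ih =>
    intro hw
    obtain ⟨T, hT1, hT2⟩ := ih (by omega)
    set Q := ((G + W + 1) * (2 * Fintype.card ι + 1)) ^ (m + W) with hQ
    -- The set of next rows must depend on the matrix `M` alone, not on the `u` producing it;
    -- unreachable `M` get the empty set.
    have hstep : ∀ M : Fin (m + w) → ι → ℤ, ∃ S : Finset (ι → ℤ),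
        ((∃ u : (w' : Fin w) → Fin (m + w') → ℝ, (∀ w' i, u w' i ∈ Set.Icc (0 : ℝ) 1) ∧
          M = addFloorRows R w u) →
          ∀ v : Fin (m + w) → ℝ, (∀ i, v i ∈ Set.Icc (0 : ℝ) 1) →
            (fun c => ⌊∑ i, v i * (M i c : ℝ)⌋) ∈ S) ∧ S.card ≤ Q := by
      intro M
      by_cases hM : ∃ u : (w' : Fin w) → Fin (m + w') → ℝ,
        (∀ w' i, u w' i ∈ Set.Icc (0 : ℝ) 1) ∧ M = addFloorRows R w u
      · obtain ⟨u, hu, rfl⟩ := hM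
        have hwW : (w : ℝ) ≤ W := by exact_mod_cast (by omega : w ≤ W)
        obtain ⟨S, hS1, hS2⟩ := exists_finset_next_row R B hB G w hG
          (fun c => by linarith [hBG c]) u hu
        refine ⟨S, fun _ => hS1, hS2.trans ?_⟩
        rw [hQ, mul_pow]
        refine Nat.mul_le_mul ?_ (Nat.pow_le_pow_right (by omega) (by omega))
        exact (Nat.pow_le_pow_left (by omega) _).trans (Nat.pow_le_pow_right (by omega) (by omega))
      · exact ⟨∅, fun h => absurd h hM, by simp⟩
    choose S hS1 hS2 using hstep
    refine ⟨T.biUnion fun M =>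
      (S M).image fun r => Fin.snoc (α := fun _ => ι → ℤ) M r, ?_, ?_⟩
    · intro u hu
      refine Finset.mem_biUnion.2 ⟨addFloorRows R w fun w' => u w'.castSucc,
        hT1 _ fun w' i => hu w'.castSucc i, Finset.mem_image.2 ⟨_, ?_, rfl⟩⟩
      exact hS1 _ ⟨_, fun w' i => hu w'.castSucc i, rfl⟩ _ (hu (Fin.last w))
    · refine (Finset.card_biUnion_le_card_mul _ _ Q fun M _ =>
        Finset.card_image_le.trans (hS2 M)).trans ?_
      rw [pow_succ]
      exact Nat.mul_le_mul_right _ hT2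

/-! ### Cuts of integer programs as rounded rows -/

namespace IntProg

lemma addCGs_c {m n : ℕ} (P : IntProg m n) (W : ℕ) (u : (w : Fin W) → Fin (m + w) → ℝ) :
    (P.addCGs W u).c = P.c := by
  induction W with
  | zero => rfl
  | succ W ih => exact ih _

lemma addCG_eq_addFloorRow {m n : ℕ} {ι : Type*} (P : IntProg m n) (R : Fin m → ι → ℤ)
    (e : Fin n → ι) (e' : ι) (hA : ∀ i j, P.A i j = R i (e j)) (hb : ∀ i, P.b i = R i e')
    (u : Fin m → ℝ) :
    (∀ i j, (P.addCG u).A i j = addFloorRow R u i (e j)) ∧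
      ∀ i, (P.addCG u).b i = addFloorRow R u i e' := by
  constructor
  · intro i j
    refine Fin.lastCases ?_ (fun i => ?_) i
    · refine (congrFun (Fin.snoc_last (α := fun _ => Fin n → ℤ) _ _) j).trans ?_
      simp only [addFloorRow, Fin.snoc_last, hA]
    · refine (congrFun (Fin.snoc_castSucc (α := fun _ => Fin n → ℤ) _ _ i) j).trans ?_
      simpa only [addFloorRow, Fin.snoc_castSucc] using hA i j
  · intro i
    refine Fin.lastCases ?_ (fun i => ?_) i
    · simp only [addCG, addFloorRow, Fin.snoc_last, hb]
    · simpa only [addCG, addFloorRow, Fin.snoc_castSucc] using hb i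

/-- Rounding treats columns independently, so `R` may contain further columns, in particular those
of other programs cut with the same `u`. -/
lemma addCGs_eq_addFloorRows {m n : ℕ} {ι : Type*} (P : IntProg m n) (R : Fin m → ι → ℤ)
    (e : Fin n → ι) (e' : ι) (hA : ∀ i j, P.A i j = R i (e j)) (hb : ∀ i, P.b i = R i e') (W : ℕ)
    (u : (w : Fin W) → Fin (m + w) → ℝ) :
    (∀ i j, (P.addCGs W u).A i j = addFloorRows R W u i (e j)) ∧
      ∀ i, (P.addCGs W u).b i = addFloorRows R W u i e' := by
  induction W with
  | zero => exact ⟨hA, hb⟩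
  | succ W ih =>
    obtain ⟨h1, h2⟩ := ih fun w => u w.castSucc
    exact addCG_eq_addFloorRow _ _ e e' h1 h2 _

lemma eq_of_fields {m n : ℕ} {P Q : IntProg m n} (hc : P.c = Q.c) (hA : P.A = Q.A)
    (hb : P.b = Q.b) : P = Q := by
  cases P; cases Q; simp_all

lemma sum_abs_col_le_normA {m n : ℕ} (P : IntProg m n) (j : Fin n) :
    ∑ i, |(P.A i j : ℝ)| ≤ P.normA :=
  Finset.sum_le_sum fun i _ => Finset.single_le_sum (f := fun j => |(P.A i j : ℝ)|)
    (fun _ _ => abs_nonneg _) (Finset.mem_univ j)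

lemma addFloorRow_zero {k : ℕ} {ι : Type*} (u : Fin k → ℝ) :
    addFloorRow (fun (_ : Fin k) (_ : ι) => (0 : ℤ)) u = fun _ _ => 0 := by
  funext i c
  refine Fin.lastCases ?_ (fun i => ?_) i <;> simp [addFloorRow]

lemma addFloorRows_zero {m W : ℕ} {ι : Type*} (u : (w : Fin W) → Fin (m + w) → ℝ) :
    addFloorRows (fun (_ : Fin m) (_ : ι) => (0 : ℤ)) W u = fun _ _ => 0 := by
  induction W with
  | zero => rfl
  | succ W ih =>
    rw [addFloorRows, ih]
    exact addFloorRow_zero _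

/-- Cuts of a program with `A = 0` and `b = 0` are trivial. -/
lemma addCGs_eq_of_norm_lt_one {m n W : ℕ} (P : IntProg m n) (hA : P.normA < 1)
    (hb : P.normb < 1) (u u' : (w : Fin W) → Fin (m + w) → ℝ) :
    P.addCGs W u = P.addCGs W u' := by
  have small : ∀ z : ℤ, |(z : ℝ)| < 1 → z = 0 := fun z hz => by
    exact Int.abs_lt_one_iff.1 (by exact_mod_cast hz)
  have hA0 : ∀ i j, P.A i j = 0 := fun i j => small _ (lt_of_le_of_lt
    ((Finset.single_le_sum (f := fun i => |(P.A i j : ℝ)|) (fun _ _ => abs_nonneg _)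
      (Finset.mem_univ i)).trans (P.sum_abs_col_le_normA j)) hA)
  have hb0 : ∀ i, P.b i = 0 := fun i => small _ (lt_of_le_of_lt
    (Finset.single_le_sum (f := fun i => |(P.b i : ℝ)|) (fun _ _ => abs_nonneg _)
      (Finset.mem_univ i)) hb)
  have key := P.addCGs_eq_addFloorRows (fun _ (_ : Unit) => 0) (fun _ => ()) () hA0 hb0 W
  simp only [addFloorRows_zero] at key
  refine eq_of_fields (by rw [addCGs_c, addCGs_c]) ?_ ?_
  · funext i j; rw [(key u).1, (key u').1]
  · funext i; rw [(key u).2, (key u').2]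

end IntProg

/-! ### From shattering to a bound on `N` -/

/-- The joint matrix has `N * (n + 1)` columns, each of absolute sum at most `α + β`. Its rounded
form determines all `N` cut programs, hence the realized pattern, so the number of patterns is at
most the number of rounded matrices. -/
lemma two_pow_le_of_pseudoShatters {m n W : ℕ} (R : BBRules (m + W) n) (κ : ℕ) {α β : ℝ}
    (hα : 0 ≤ α) (hβ : 0 ≤ β) (hW : 1 ≤ W) {N : ℕ}
    (h : PseudoShatters (treeSizeClass R κ α β : Set (BoundedIP m n α β → ℝ)) N) :
    2 ^ N ≤ (((⌈α + β⌉₊ + W + W + 1) * (2 * (N * (n + 1)) + 1)) ^ (m + W)) ^ W := by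
  classical
  obtain ⟨y, r, hσ⟩ := h
  choose f hf hfσ using hσ
  choose u hu hfu using hf
  let M : Fin m → Fin N × Option (Fin n) → ℤ := fun i c =>
    c.2.elim ((y c.1).1.b i) (fun j => (y c.1).1.A i j)
  have hM : ∀ c, ∑ i, |(M i c : ℝ)| ≤ α + β := by
    rintro ⟨k, _ | j⟩
    · exact (y k).2.2.trans (by linarith)
    · exact ((y k).1.sum_abs_col_le_normA j).trans ((y k).2.1.trans (by linarith))
  obtain ⟨T, hT1, hT2⟩ := exists_finset_addFloorRows M (fun _ => α + β) hM (⌈α + β⌉₊ + W) W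
    (by omega) (fun _ => by push_cast; linarith [Nat.le_ceil (α + β)]) W le_rfl
  have hinj : Function.Injective fun σ : Fin N → Bool => addFloorRows M W (u σ) := by
    intro σ σ' hh
    simp only at hh
    have hP : ∀ k, (y k).1.addCGs W (u σ) = (y k).1.addCGs W (u σ') := by
      intro k
      have key := (y k).1.addCGs_eq_addFloorRows M (fun j => (k, some j)) (k, none)
        (fun _ _ => rfl) (fun _ => rfl) W
      refine IntProg.eq_of_fields (by rw [IntProg.addCGs_c, IntProg.addCGs_c]) ?_ ?_
      · funext i j; rw [(key _).1, (key _).1, hh]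
      · funext i; rw [(key _).2, (key _).2, hh]
    funext k
    rw [Bool.eq_iff_iff, ← hfσ σ k, ← hfσ σ' k, hfu σ, hfu σ']
    simp only [hP]
  have hcard : (Finset.univ.image fun σ : Fin N → Bool => addFloorRows M W (u σ)).card = 2 ^ N := by
    rw [Finset.card_image_of_injective _ hinj]; simp
  rw [← hcard]
  refine (Finset.card_le_card fun x hx => ?_).trans (hT2.trans (le_of_eq ?_))
  · obtain ⟨σ, -, rfl⟩ := Finset.mem_image.1 hx
    exact hT1 _ (hu σ)
  · simp

/-- Integrality forces `A = 0` and `b = 0`, so the tree size is independent of `u` and no input can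
lie on both sides of its threshold. -/
lemma eq_zero_of_pseudoShatters_of_lt_one {m n W : ℕ} (R : BBRules (m + W) n) (κ : ℕ) {α β : ℝ}
    (hα : α < 1) (hβ : β < 1) {N : ℕ}
    (h : PseudoShatters (treeSizeClass R κ α β : Set (BoundedIP m n α β → ℝ)) N) : N = 0 := by
  obtain ⟨y, r, hσ⟩ := h
  by_contra hN
  let k : Fin N := ⟨0, Nat.pos_of_ne_zero hN⟩
  obtain ⟨f, ⟨u, -, rfl⟩, h1⟩ := hσ fun _ => true
  obtain ⟨f', ⟨u', -, rfl⟩, h2⟩ := hσ fun _ => false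
  have h3 := (h1 k).2 rfl
  have h4 := (h2 k).1
  beta_reduce at h3 h4
  rw [(y k).1.addCGs_eq_of_norm_lt_one ((y k).2.1.trans_lt hα) ((y k).2.2.trans_lt hβ) u u'] at h3
  exact absurd (h4 h3) (by simp)

/-- The exponential inequality for `N` turned into an explicit bound on `N`. -/
lemma le_of_two_pow_le {m n W N s : ℕ} {a : ℝ} (hm : 1 ≤ m) (hn : 1 ≤ n) (hW : 1 ≤ W) (ha : 0 ≤ a)
    (hs : (s : ℝ) ≤ a + 1) (hX : 2 ≤ m * W * (a + n))
    (h : 2 ^ N ≤ (((s + W + W + 1) * (2 * (N * (n + 1)) + 1)) ^ (m + W)) ^ W) :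
    (N : ℝ) ≤ 100 * (m * W ^ 2 * Real.log (m * W * (a + n))) := by
  rcases Nat.eq_zero_or_pos N with rfl | hN
  · have := Real.log_nonneg (by linarith : (1 : ℝ) ≤ m * W * (a + n))
    simp only [Nat.cast_zero]
    positivity
  have hm' : (1 : ℝ) ≤ m := by exact_mod_cast hm
  have hn' : (1 : ℝ) ≤ n := by exact_mod_cast hn
  have hW' : (1 : ℝ) ≤ W := by exact_mod_cast hW
  have hN' : (1 : ℝ) ≤ N := by exact_mod_cast hN
  set X : ℝ := m * W * (a + n) with hXdef
  set P : ℝ := m * W ^ 2 with hPdef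
  set L := Real.log X with hL
  have hX0 : 0 < X := by linarith
  have hP1 : 1 ≤ P := one_le_mul_of_one_le_of_one_le hm' (one_le_pow₀ hW')
  have hlog2 := Real.log_two_gt_d9
  have hL2 : Real.log 2 ≤ L := Real.log_le_log (by norm_num) hX
  have hWX : W * (a + n) ≤ X := by
    rw [hXdef, mul_assoc]
    exact le_mul_of_one_le_left (by positivity) hm'
  have hWa : a ≤ W * a := le_mul_of_one_le_left ha hW'
  have hWn : (W : ℝ) ≤ W * n := le_mul_of_one_le_right (by linarith) hn'
  have hnX : (n : ℝ) ≤ X := by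
    have : a + n ≤ W * (a + n) := le_mul_of_one_le_left (by linarith) hW'
    linarith
  have h1 : (s : ℝ) + W + W + 1 ≤ 4 * X := by nlinarith
  have h2 : 2 * ((N : ℝ) * (n + 1)) + 1 ≤ 5 * (N * X) := by
    have h3 : (1 : ℝ) ≤ N * n := one_le_mul_of_one_le_of_one_le hN' hn'
    have h4 : (N : ℝ) ≤ N * n := le_mul_of_one_le_right (by linarith) hn'
    have h5 : (N : ℝ) * n ≤ N * X := by gcongr
    linarith
  have h3 : ((s : ℝ) + W + W + 1) * (2 * (N * (n + 1)) + 1) ≤ 20 * (X ^ 2 * N) := by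
    calc ((s : ℝ) + W + W + 1) * (2 * (N * (n + 1)) + 1) ≤ (4 * X) * (5 * (N * X)) := by gcongr
      _ = _ := by ring
  have h4 : (2 : ℝ) ^ N ≤ (20 * (X ^ 2 * N)) ^ ((m + W) * W) := by
    have : (2 : ℝ) ^ N ≤ (((s : ℝ) + W + W + 1) * (2 * (N * (n + 1)) + 1)) ^ ((m + W) * W) := by
      rw [pow_mul]; exact_mod_cast h
    exact this.trans (pow_le_pow_left₀ (by positivity) h3 _)
  have h5 : N * Real.log 2 ≤ ((m + W) * W : ℝ) * (Real.log 20 + (2 * L + Real.log N)) := by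
    have := Real.log_le_log (by positivity) h4
    rw [Real.log_pow, Real.log_pow, Real.log_mul (by norm_num) (by positivity),
      Real.log_mul (by positivity) (by positivity), Real.log_pow] at this
    push_cast at this
    exact this
  have h6 : ((m + W) * W : ℝ) ≤ 2 * P := by
    have e1 : (m : ℝ) * W ≤ m * W * W := le_mul_of_one_le_right (by positivity) hW'
    have e2 : (W : ℝ) * W ≤ m * (W * W) := le_mul_of_one_le_left (by positivity) hm'
    rw [hPdef]; linarith
  -- The inequality `log x ≤ x - 1` at `x = N / (8 * P)`. The scale `8 * P` turns the linear term
  -- into `N / 4` after multiplication by `2 * P`, which `N * log 2 ≥ 0.6 * N` absorbs.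
  have h7 : Real.log N ≤ N / (8 * P) + Real.log (8 * P) := by
    have h := Real.log_le_sub_one_of_pos (show (0 : ℝ) < N / (8 * P) by positivity)
    rw [Real.log_div (by positivity) (by positivity)] at h
    linarith
  have h8 : Real.log (8 * P) ≤ 3 * Real.log 2 + 2 * L := by
    have hPX : P ≤ X ^ 2 := by
      have e1 : (m * W : ℝ) ≤ X := le_mul_of_one_le_right (by positivity) (by linarith)
      calc P ≤ m * P := le_mul_of_one_le_left (by positivity) hm'
        _ = (m * W) ^ 2 := by rw [hPdef]; ring
        _ ≤ X ^ 2 := by gcongr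
    have := Real.log_le_log (by positivity) (show 8 * P ≤ 2 ^ 3 * X ^ 2 by linarith)
    rw [Real.log_mul (x := 2 ^ 3) (by positivity) (by positivity), Real.log_pow,
      Real.log_pow] at this
    exact_mod_cast this
  have h9 : Real.log 20 ≤ 5 * Real.log 2 := by
    have := Real.log_le_log (by norm_num) (show (20 : ℝ) ≤ 2 ^ 5 by norm_num)
    rwa [Real.log_pow] at this
  have hlog20 : 0 ≤ Real.log 20 := Real.log_nonneg (by norm_num)
  have hlogN : 0 ≤ Real.log N := Real.log_nonneg hN'
  have h10 : N * Real.log 2 ≤ 2 * P * (12 * L + N / (8 * P)) :=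
    h5.trans (mul_le_mul h6 (by linarith) (by linarith) (by positivity))
  have h11 : 2 * P * (12 * L + N / (8 * P)) = 24 * (P * L) + N / 4 := by field_simp; ring
  have h12 : (N : ℝ) * 0.6 ≤ N * Real.log 2 := by gcongr; linarith
  have h13 : 0 ≤ P * L := mul_nonneg (by linarith) (by linarith)
  linarith

theorem theorem3 :
    ∃ C : ℝ, 0 < C ∧
      ∀ (m n W : ℕ), 1 ≤ m → 1 ≤ n → 1 ≤ W →
      ∀ (α β : ℝ), 0 ≤ α → 0 ≤ β →
      ∀ (κ : ℕ) (R : BBRules (m + W) n),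
        ∃ d : ℕ, pseudoDim (treeSizeClass R κ α β : Set (BoundedIP m n α β → ℝ)) = d ∧
          (d : ℝ) ≤ C * (m * W ^ 2 * Real.log (m * W * (α + β + n))) := by
  refine ⟨100, by norm_num, fun m n W hm hn hW α β hα hβ κ R => ?_⟩
  have hm' : (1 : ℝ) ≤ m := by exact_mod_cast hm
  have hn' : (1 : ℝ) ≤ n := by exact_mod_cast hn
  have hW' : (1 : ℝ) ≤ W := by exact_mod_cast hW
  have hmW : (1 : ℝ) ≤ m * W := one_le_mul_of_one_le_of_one_le hm' hW'
  have hX1 : 1 ≤ m * W * (α + β + n) := one_le_mul_of_one_le_of_one_le hmW (by linarith)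
  set b := 100 * (m * W ^ 2 * Real.log (m * W * (α + β + n))) with hb
  have hb0 : 0 ≤ b := by
    have := Real.log_nonneg hX1
    positivity
  have hN : ∀ N, PseudoShatters (treeSizeClass R κ α β : Set (BoundedIP m n α β → ℝ)) N →
      (N : ℝ) ≤ b := by
    intro N h
    -- The logarithm can be arbitrarily close to `0`, or equal to it, when its argument is below
    -- `2`; since `n ≥ 1`, then `α + β < 1` and only `N = 0` is possible.
    rcases lt_or_ge (m * W * (α + β + n)) 2 with hX | hX
    · have h1 : α + β + n ≤ m * W * (α + β + n) := le_mul_of_one_le_left (by linarith) hmW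
      rw [eq_zero_of_pseudoShatters_of_lt_one R κ (by linarith) (by linarith) h]
      simpa using hb0
    · exact le_of_two_pow_le hm hn hW (add_nonneg hα hβ) (Nat.ceil_lt_add_one (by linarith)).le hX
        (two_pow_le_of_pseudoShatters R κ hα hβ hW h)
  have hle : pseudoDim (treeSizeClass R κ α β : Set (BoundedIP m n α β → ℝ)) ≤ (⌊b⌋₊ : ℕ∞) :=
    iSup₂_le fun N h => by exact_mod_cast Nat.le_floor (hN N h)
  obtain ⟨d, hd⟩ := ENat.ne_top_iff_exists.1 (ne_top_of_le_ne_top (ENat.natCast_ne_top _) hle)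
  refine ⟨d, hd.symm, ?_⟩
  rw [← hd] at hle
  exact (Nat.le_floor_iff hb0).1 (by exact_mod_cast hle)
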